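/- A function $f\colon 2^N\to\mathbb{R}_{\ge 0}$ on a finite set $N$ is monotone if $f(A)\le f(B)$ whenever $A\subseteq B$. Write $f(x\mid A)=f(A\cup\{x\})-f(A)$. For $\gamma\in(0,1]$, $f$ is $\gamma$-weakly DR if $f(x\mid A)\ge\gamma\, f(x\mid B)$ for all $A\subseteq B\subseteq N$ and $x\notin B$; for $\gamma=1$ this is submodularity. Let $\mathrm{OPT}_k(f)=\max_{S\subseteq N,\,|S|\le k} f(S)$. A value query asks for $f(S)$ for one set $S\subseteq N$; algorithms are adaptive and otherwise computationally unrestricted. For every $\gamma\in(0,1]$, every $\varepsilon>0$ and every polynomial $C$ there exists $k_0=k_0(\gamma,\varepsilon,C)$ such that for all $k\ge k_0$ and every $p\ge k$ the following holds. Let $N$ be a set with $|N|=\lceil 60p/\varepsilon\rceil$. For every (possibly randomized) algorithm that, on every monotone $\gamma$-weakly DR function $f\colon 2^N\to\mathbb{R}_{\ge 0}$, makes at most $C(|N|)$ value queries and outputs a set $P\subseteq N$ with $|P|\le p$, there is such an $f$ with \[ \mathbb{E}\Bigl[\max_{S\subseteq P,\,|S|\le k} f(S)\Bigr] < (1-e^{-\gamma}+\varepsilon)\cdot\mathrm{OPT}_k(f).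 \] That is, no such algorithm can guarantee an expected value of at least $(1-e^{-\gamma}+\varepsilon)\,\mathrm{OPT}_k(f)$ for all these $f$. In particular, taking $\gamma=1$: for every $\alpha>1-1/e$ and every polynomial $C$ there exists $k_0=k_0(\alpha,C)$ such that for all $k\ge k_0$ and every $p\ge k$, on ground sets with $|N|=\lceil 60p/(\alpha-1+1/e)\rceil$, no (possibly randomized) algorithm that makes at most $C(|N|)$ value queries and outputs $P\subseteq N$ with $|P|\le p$ can guarantee $\mathbb{E}[\max_{S\subseteq P,\,|S|\le k} f(S)]\ge\alpha\cdot\mathrm{OPT}_k(f)$ for all monotone submodular $f\colon 2^N\to\mathbb{R}_{\ge 0}$. So pruning budget beyond $k$ cannot improve the containment factor beyond $1-1/e$. -/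

import Mathlib

open MeasureTheory

universe u v

/-- A deterministic adaptive value-query algorithm on the ground set `N`: it either stops and outputs
a set, or asks for the value of a set and continues depending on the real number received.
There is no restriction on computation between queries. -/
inductive QueryAlg (N : Type*) : Type _
  | output (P : Finset N) : QueryAlg N
  | query (S : Finset N) (next : ℝ → QueryAlg N) : QueryAlg N

namespace QueryAlg

variable {N : Type*}

/-- The set that the algorithm outputs when its value queries are answered by `f`. -/
def result (f : Finset N → ℝ) : QueryAlg N → Finset N
  | output P => P
  | query S next => result f (next (f S))

/-- The number of value queries that the algorithm makes when they are answered by `f`. -/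
def numQueries (f : Finset N → ℝ) : QueryAlg N → ℕ
  | output _ => 0
  | query S next => numQueries f (next (f S)) + 1

end QueryAlg

section SetFunctions

variable {N : Type*} [DecidableEq N]

/-- The marginal gain `f(x ∣ A) = f(A ∪ {x}) - f(A)`. -/
def marginal (f : Finset N → ℝ) (x : N) (A : Finset N) : ℝ := f (insert x A) - f A

/-- `γ`-weakly diminishing returns. -/
def IsWeaklyDR (γ : ℝ) (f : Finset N → ℝ) : Prop :=
  ∀ A B : Finset N, A ⊆ B → ∀ x ∉ B, γ * marginal f x B ≤ marginal f x A

/-- Submodularity, in the form of diminishing marginal gains. -/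
def IsSubmodular (f : Finset N → ℝ) : Prop :=
  ∀ A B : Finset N, A ⊆ B → ∀ x ∉ B, marginal f x B ≤ marginal f x A

/-- The non-negative monotone `γ`-weakly DR set functions on `N`. -/
def monotoneWeaklyDR (γ : ℝ) (N : Type*) [DecidableEq N] : Set (Finset N → ℝ) :=
  {f | (∀ S, 0 ≤ f S) ∧ Monotone f ∧ IsWeaklyDR γ f}

/-- The non-negative monotone submodular set functions on `N`. -/
def monotoneSubmodular (N : Type*) [DecidableEq N] : Set (Finset N → ℝ) :=
  {f | (∀ S, 0 ≤ f S) ∧ Monotone f ∧ IsSubmodular f}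

theorem feasible_nonempty {N : Type*} (P : Finset N) (k : ℕ) :
    (P.powerset.filter (fun S => S.card ≤ k)).Nonempty :=
  ⟨∅, by simp⟩

/-- `max {f(S) : S ⊆ P, |S| ≤ k}`. -/
noncomputable def bestValue {N : Type*} (f : Finset N → ℝ) (P : Finset N) (k : ℕ) : ℝ :=
  (P.powerset.filter (fun S => S.card ≤ k)).sup' (feasible_nonempty P k) f

/-- `OPT_k = max {f(S) : S ⊆ N, |S| ≤ k}`. -/
noncomputable def optValue {N : Type*} [Fintype N] (f : Finset N → ℝ) (k : ℕ) : ℝ :=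
  bestValue f Finset.univ k

end SetFunctions

/-- A randomized algorithm is a random deterministic algorithm `A ω`, with `ω` drawn from `μ`.
This says that on every input `f` from the class `F` its output is a random set (an event is
measurable as soon as it is described by the output) and that, almost surely, it makes at most `q`
value queries and outputs a set of at most `p` elements. -/
def IsRandomizedPruner {Ω N : Type*} [MeasurableSpace Ω] (μ : Measure Ω) (A : Ω → QueryAlg N)
    (F : Set (Finset N → ℝ)) (q : ℝ) (p : ℕ) : Prop :=
  ∀ f ∈ F,
    (∀ P : Finset N, MeasurableSet {ω | (A ω).result f = P}) ∧
    ∀ᵐ ω ∂μ, ((A ω).numQueries f : ℝ) ≤ q ∧ ((A ω).result f).card ≤ p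

/-- No randomized algorithm with at most `q` value queries and output size at most `p` can guarantee
`E[max {f(S) : S ⊆ P, |S| ≤ k}] ≥ α · OPT_k` for its output `P` on all `f` in the class `F`. -/
def NoPrunerGuarantees {N : Type v} [Fintype N] (F : Set (Finset N → ℝ))
    (q : ℝ) (p k : ℕ) (α : ℝ) : Prop :=
  ∀ (Ω : Type u) [MeasurableSpace Ω] (μ : Measure Ω) [IsProbabilityMeasure μ]
    (A : Ω → QueryAlg N), IsRandomizedPruner μ A F q p →
    ∃ f ∈ F, ∫ ω, bestValue f ((A ω).result f) k ∂μ < α * optValue f k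

/-!
The proof hides a uniformly random set `O` of `k` elements, and shows that an algorithm with
polynomially many queries almost never notices it.

Put `m = ⌊ε k / 3⌋` and `K = k - m`. The instance `hiddenFun γ K m O` is
`f_O(S) = 1 - (1 - (a - m)⁺ / K) * h(b + min a m)` with `a = |S ∩ O|` and `b = |S \ O|`, where the
profile `h` is `(1 - γ / K) ^ t` for `t ≤ K` and then decreases linearly to `0` at `t = 2 K`. Three
facts about it carry the argument.

* It is monotone and `γ`-weakly DR (`hiddenFun_mem`). A hidden element gains `h / K`, an ordinary one
  about `γ h / K`, a ratio of exactly the size that `γ`-weak DR tolerates.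
* `f_O(O) = 1`, while a set of at most `k` elements with few hidden ones has value about
  `1 - h(k) ≈ 1 - exp (-γ)` (`hiddenFun_self`, `hiddenFun_le`).
* `f_O(S)` differs from the symmetric function `g(S) = 1 - h(|S|)` only if `|S| < 3 K` and
  `|S ∩ O| > m`. Because the profile vanishes from `2 K` on, sets much larger than `k`, which meet `O`
  in many elements, give no information. As `|N| ≥ 60 k / ε`, the expected size of `S ∩ O` is below
  `m` by a constant factor, and a union bound makes such an `S` exponentially unlikely in `m`, and
  even more so when `|N|` is large compared with `k` (`card_large_inter_le`). This beats every
  polynomial in `|N|` uniformly in `p` (`exists_forall_eval_mul_pow_le`).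

Until its first separating query the algorithm runs on `f_O` as it does on `g`
(`card_result_ne_le`). Hence its output is mostly a set `P` that does not depend on `O`; it contains
on average only `p k / |N| ≤ ε k / 60` elements of `O`, which are worth little. So the average value
over `O` is below `1 - exp (-γ) + ε` (`sum_bestValue_hiddenFun_le`), and some `O` is bad for the
randomized algorithm by averaging (`exists_integral_lt_of_sum_le`). For `ε > 1` the factor exceeds
`1`, and a constant function suffices.
-/

/-! ### The gain profile -/

/-- The uncovered fraction `h t` after `t` ordinary elements: it decays geometrically with ratio
`1 - γ / K` up to `t = K` and then falls linearly, reaching `0` at `t = 2 * K`. The linear part is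
steeper than the geometric one by a factor of about `1 / γ`, which is the most that the `γ`-weak DR
condition allows. -/
noncomputable def profile (γ : ℝ) (K t : ℕ) : ℝ :=
  (1 - γ / K) ^ min t K * (((2 * K - max t K : ℕ) : ℝ) / K)

section Profile

variable {γ : ℝ} {K : ℕ}

theorem profile_of_le (hK : 0 < K) {t : ℕ} (ht : t ≤ K) : profile γ K t = (1 - γ / K) ^ t := by
  have hK' : (K : ℝ) ≠ 0 := by positivity
  have h : 2 * K - K = K := by omega
  rw [profile, min_eq_left ht, max_eq_right ht, h, div_self hK', mul_one]

theorem profile_of_ge {t : ℕ} (ht : K ≤ t) :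
    profile γ K t = (1 - γ / K) ^ K * (((2 * K - t : ℕ) : ℝ) / K) := by
  rw [profile, min_eq_right ht, max_eq_left ht]

theorem profile_eq_zero {t : ℕ} (ht : 2 * K ≤ t) : profile γ K t = 0 := by
  rw [profile_of_ge (by omega), Nat.sub_eq_zero_of_le ht]
  simp

theorem profile_zero (hK : 0 < K) : profile γ K 0 = 1 := by
  rw [profile_of_le hK (Nat.zero_le K), pow_zero]

theorem ratio_nonneg (hγ : γ ≤ 1) (hK : 0 < K) : 0 ≤ 1 - γ / K := by
  have hK' : (1 : ℝ) ≤ K := by exact_mod_cast hK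
  have : γ / K ≤ 1 := by
    rw [div_le_one (by linarith)]
    linarith
  linarith

theorem ratio_le_one (hγ : 0 ≤ γ) : 1 - γ / K ≤ 1 := by
  have : 0 ≤ γ / K := by positivity
  linarith

theorem profile_nonneg (hγ : γ ≤ 1) (hK : 0 < K) (t : ℕ) : 0 ≤ profile γ K t :=
  mul_nonneg (pow_nonneg (ratio_nonneg hγ hK) _) (by positivity)

theorem profile_sub_succ_of_lt (hK : 0 < K) {t : ℕ} (ht : t < K) :
    profile γ K t - profile γ K (t + 1) = γ / K * (1 - γ / K) ^ t := by
  rw [profile_of_le hK ht.le, profile_of_le hK ht, pow_succ]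
  ring

theorem profile_sub_succ_of_ge {t : ℕ} (ht : K ≤ t) (ht' : t < 2 * K) :
    profile γ K t - profile γ K (t + 1) = (1 - γ / K) ^ K / K := by
  rw [profile_of_ge ht, profile_of_ge (by omega)]
  have h : ((2 * K - t : ℕ) : ℝ) = ((2 * K - (t + 1) : ℕ) : ℝ) + 1 := by
    exact_mod_cast (by omega : 2 * K - t = 2 * K - (t + 1) + 1)
  rw [h]
  ring

/-- A step of the profile is at least `γ / K` times its current value, so that a hidden element
gains at most `1 / γ` times as much as an ordinary one. -/
theorem profile_decay (hγ : γ ≤ 1) (hK : 0 < K) (t : ℕ) :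
    γ * (profile γ K t / K) ≤ profile γ K t - profile γ K (t + 1) := by
  have hr := pow_nonneg (ratio_nonneg hγ hK) K
  rcases lt_or_ge t K with h | h
  · rw [profile_sub_succ_of_lt hK h, profile_of_le hK h.le]
    exact le_of_eq (by ring)
  rcases lt_or_ge t (2 * K) with h' | h'
  · rw [profile_sub_succ_of_ge h h', profile_of_ge h, ← mul_div_assoc]
    have hq : ((2 * K - t : ℕ) : ℝ) / K ≤ 1 := by
      rw [div_le_one (by exact_mod_cast hK)]
      exact_mod_cast (by omega : 2 * K - t ≤ K)
    have hq0 : 0 ≤ ((2 * K - t : ℕ) : ℝ) / K := by positivity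
    gcongr
    calc γ * ((1 - γ / K) ^ K * (((2 * K - t : ℕ) : ℝ) / K))
        ≤ 1 * ((1 - γ / K) ^ K * 1) := by gcongr
      _ = (1 - γ / K) ^ K := by ring
  · simp [profile_eq_zero h', profile_eq_zero (γ := γ) (h'.trans t.le_succ)]

theorem profile_antitone (hγ0 : 0 ≤ γ) (hγ : γ ≤ 1) (hK : 0 < K) : Antitone (profile γ K) := by
  refine antitone_nat_of_succ_le fun t => ?_
  have h1 := profile_decay hγ hK t
  have h2 : 0 ≤ γ * (profile γ K t / K) :=
    mul_nonneg hγ0 (div_nonneg (profile_nonneg hγ hK t) (Nat.cast_nonneg K))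
  linarith

theorem profile_le_one (hγ0 : 0 ≤ γ) (hγ : γ ≤ 1) (hK : 0 < K) (t : ℕ) : profile γ K t ≤ 1 :=
  (profile_antitone hγ0 hγ hK (Nat.zero_le t)).trans_eq (profile_zero hK)

theorem profile_step_le (hγ0 : 0 ≤ γ) (hγ : γ ≤ 1) (hK : 0 < K) {t t' : ℕ} (htt : t ≤ t') :
    γ * (profile γ K t' - profile γ K (t' + 1)) ≤ profile γ K t - profile γ K (t + 1) := by
  have hr0 := ratio_nonneg hγ hK
  have hr1 := ratio_le_one (K := K) hγ0
  have hrK := pow_nonneg hr0 K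
  rcases lt_or_ge t' (2 * K) with h2 | h2
  · rcases lt_or_ge t' K with h' | h'
    · rw [profile_sub_succ_of_lt hK h', profile_sub_succ_of_lt hK (htt.trans_lt h')]
      have : (1 - γ / K) ^ t' ≤ (1 - γ / K) ^ t := pow_le_pow_of_le_one hr0 hr1 htt
      calc γ * (γ / K * (1 - γ / K) ^ t') ≤ 1 * (γ / K * (1 - γ / K) ^ t) := by gcongr
        _ = _ := one_mul _
    · rw [profile_sub_succ_of_ge h' h2]
      rcases lt_or_ge t K with h | h
      · rw [profile_sub_succ_of_lt hK h]
        have : (1 - γ / K) ^ K ≤ (1 - γ / K) ^ t := pow_le_pow_of_le_one hr0 hr1 h.le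
        calc γ * ((1 - γ / K) ^ K / K) ≤ γ * ((1 - γ / K) ^ t / K) := by gcongr
          _ = _ := by ring
      · rw [profile_sub_succ_of_ge h (htt.trans_lt h2)]
        exact mul_le_of_le_one_left (by positivity) hγ
  · rw [profile_eq_zero h2, profile_eq_zero (h2.trans t'.le_succ)]
    have := profile_antitone hγ0 hγ hK t.le_succ
    simp only [sub_self, mul_zero]
    exact sub_nonneg.2 this

/-- Overshooting `K` by `m` elements costs at most `m / K`. -/
theorem le_profile_add (hγ0 : 0 ≤ γ) (hγ : γ ≤ 1) (hK : 0 < K) (m : ℕ) :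
    (1 - γ / K) ^ K - m / K ≤ profile γ K (K + m) := by
  rw [profile_of_ge (Nat.le_add_right K m)]
  have hK' : (0 : ℝ) < K := by exact_mod_cast hK
  have hsub : (K : ℝ) - m ≤ ((2 * K - (K + m) : ℕ) : ℝ) := by
    rw [sub_le_iff_le_add]
    exact_mod_cast (by omega : K ≤ 2 * K - (K + m) + m)
  have hr0 := pow_nonneg (ratio_nonneg hγ hK) K
  have hr1 : (1 - γ / K) ^ K ≤ 1 := pow_le_one₀ (ratio_nonneg hγ hK) (ratio_le_one hγ0)
  have hm : (0 : ℝ) ≤ m / K := by positivity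
  calc (1 - γ / K) ^ K - m / K ≤ (1 - γ / K) ^ K * (1 - m / K) := by nlinarith
    _ = (1 - γ / K) ^ K * ((K - m) / K) := by rw [sub_div, div_self hK'.ne']
    _ ≤ _ := by gcongr

end Profile

/-! ### The hidden-set functions -/

section HiddenSet

variable {N : Type*} [DecidableEq N]

/-- The instance with hidden set `O`. The first `m` elements of `O` in `S` count as ordinary
elements, and each further one removes the share `1 / K` of the uncovered part. With `O = ∅` this is
the symmetric function `1 - profile γ K #S`. -/
noncomputable def hiddenFun (γ : ℝ) (K m : ℕ) (O S : Finset N) : ℝ :=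
  1 - (1 - (((S ∩ O).card - m : ℕ) : ℝ) / K) *
    profile γ K ((S \ O).card + min (S ∩ O).card m)

variable {γ : ℝ} {K m : ℕ}

theorem hiddenFun_empty (S : Finset N) : hiddenFun γ K m ∅ S = 1 - profile γ K S.card := by
  simp [hiddenFun]

theorem hiddenFun_eq_of_card_inter_le {O S : Finset N} (h : (S ∩ O).card ≤ m) :
    hiddenFun γ K m O S = hiddenFun γ K m ∅ S := by
  rw [hiddenFun_empty, hiddenFun, Nat.sub_eq_zero_of_le h, min_eq_left h,
    Finset.card_sdiff_add_card_inter]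
  simp

/-- Large sets have full value whatever the hidden set is. -/
theorem hiddenFun_eq_of_card_ge {O S : Finset N} (hO : O.card ≤ K + m) (h : 3 * K ≤ S.card) :
    hiddenFun γ K m O S = hiddenFun γ K m ∅ S := by
  have h1 := Finset.card_sdiff_add_card_inter S O
  have h2 : (S ∩ O).card ≤ O.card := Finset.card_le_card Finset.inter_subset_right
  rw [hiddenFun_empty, hiddenFun, profile_eq_zero (by omega), profile_eq_zero (by omega), mul_zero]

theorem hiddenFun_self (hK : 0 < K) {O : Finset N} (hO : O.card = K + m) :
    hiddenFun γ K m O O = 1 := by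
  have hK' : (K : ℝ) ≠ 0 := by positivity
  simp [hiddenFun, hO, hK']

/-- A set of at most `K + m` elements with few hidden elements is hardly better than it is for the
symmetric function. -/
theorem hiddenFun_le (hγ0 : 0 ≤ γ) (hγ : γ ≤ 1) (hK : 0 < K) {O S : Finset N}
    (hS : S.card ≤ K + m) :
    hiddenFun γ K m O S ≤ 1 - profile γ K (K + m) + (S ∩ O).card / K := by
  have h1 := Finset.card_sdiff_add_card_inter S O
  have h2 : profile γ K (K + m) ≤ profile γ K ((S \ O).card + min (S ∩ O).card m) :=
    profile_antitone hγ0 hγ hK (by omega)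
  have h3 := profile_le_one hγ0 hγ hK ((S \ O).card + min (S ∩ O).card m)
  have h4 : (((S ∩ O).card - m : ℕ) : ℝ) / K ≤ (S ∩ O).card / K := by
    gcongr
    exact Nat.sub_le _ _
  have h5 : (0 : ℝ) ≤ (((S ∩ O).card - m : ℕ) : ℝ) / K := by positivity
  rw [hiddenFun]
  nlinarith

theorem hidden_factor_nonneg {O : Finset N} (hO : O.card ≤ K + m) (S : Finset N) :
    0 ≤ 1 - (((S ∩ O).card - m : ℕ) : ℝ) / K := by
  have h2 : (S ∩ O).card ≤ O.card := Finset.card_le_card Finset.inter_subset_right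
  rw [sub_nonneg]
  exact div_le_one_of_le₀ (by exact_mod_cast (by omega)) (Nat.cast_nonneg K)

theorem hiddenFun_le_one (hγ : γ ≤ 1) (hK : 0 < K) {O : Finset N} (hO : O.card ≤ K + m)
    (S : Finset N) : hiddenFun γ K m O S ≤ 1 :=
  sub_le_self _ (mul_nonneg (hidden_factor_nonneg hO S) (profile_nonneg hγ hK _))

theorem hiddenFun_nonneg (hγ0 : 0 ≤ γ) (hγ : γ ≤ 1) (hK : 0 < K) (O S : Finset N) :
    0 ≤ hiddenFun γ K m O S := by
  refine sub_nonneg.2 (mul_le_one₀ (sub_le_self _ (by positivity)) (profile_nonneg hγ hK _)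
    (profile_le_one hγ0 hγ hK _))

theorem hiddenFun_mono (hγ0 : 0 ≤ γ) (hγ : γ ≤ 1) (hK : 0 < K) {O : Finset N}
    (hO : O.card ≤ K + m) : Monotone (hiddenFun γ K m O) := by
  intro A B hAB
  have h1 : (A ∩ O).card ≤ (B ∩ O).card :=
    Finset.card_le_card (Finset.inter_subset_inter_right hAB)
  have h2 : (A \ O).card ≤ (B \ O).card := Finset.card_le_card (Finset.sdiff_subset_sdiff hAB le_rfl)
  refine sub_le_sub_left (mul_le_mul ?_ (profile_antitone hγ0 hγ hK (by omega))
    (profile_nonneg hγ hK _) (hidden_factor_nonneg hO A)) 1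
  gcongr

theorem marginal_hiddenFun_of_notMem {O S : Finset N} {x : N} (hx : x ∉ O) (hS : x ∉ S) :
    marginal (hiddenFun γ K m O) x S = (1 - (((S ∩ O).card - m : ℕ) : ℝ) / K) *
      (profile γ K ((S \ O).card + min (S ∩ O).card m) -
        profile γ K ((S \ O).card + min (S ∩ O).card m + 1)) := by
  have h1 : (insert x S \ O).card = (S \ O).card + 1 := by
    rw [Finset.insert_sdiff_of_notMem _ hx, Finset.card_insert_of_notMem (by simp [hS])]
  rw [marginal, hiddenFun, hiddenFun, Finset.insert_inter_of_notMem hx, h1, add_right_comm]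
  ring

theorem card_inter_insert_of_mem {O S : Finset N} {x : N} (hx : x ∈ O) (hS : x ∉ S) :
    (insert x S ∩ O).card = (S ∩ O).card + 1 := by
  rw [Finset.insert_inter_of_mem hx, Finset.card_insert_of_notMem (by simp [hS])]

theorem marginal_hiddenFun_of_mem_of_lt {O S : Finset N} {x : N} (hx : x ∈ O) (hS : x ∉ S)
    (h : (S ∩ O).card < m) :
    marginal (hiddenFun γ K m O) x S = profile γ K S.card - profile γ K (S.card + 1) := by
  have h1 : (insert x S ∩ O).card ≤ m := by rw [card_inter_insert_of_mem hx hS]; omega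
  rw [marginal, hiddenFun_eq_of_card_inter_le h1, hiddenFun_eq_of_card_inter_le h.le,
    hiddenFun_empty, hiddenFun_empty, Finset.card_insert_of_notMem hS]
  ring

theorem marginal_hiddenFun_of_mem_of_ge {O S : Finset N} {x : N} (hx : x ∈ O) (hS : x ∉ S)
    (h : m ≤ (S ∩ O).card) :
    marginal (hiddenFun γ K m O) x S = profile γ K ((S \ O).card + m) / K := by
  have h2 : (((S ∩ O).card + 1 - m : ℕ) : ℝ) = (((S ∩ O).card - m : ℕ) : ℝ) + 1 := by
    exact_mod_cast (by omega : (S ∩ O).card + 1 - m = (S ∩ O).card - m + 1)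
  rw [marginal, hiddenFun, hiddenFun, card_inter_insert_of_mem hx hS,
    Finset.insert_sdiff_of_mem _ hx, min_eq_right h, min_eq_right (h.trans (Nat.le_succ _)), h2]
  ring

theorem hiddenFun_isWeaklyDR (hγ0 : 0 ≤ γ) (hγ : γ ≤ 1) (hK : 0 < K) {O : Finset N}
    (hO : O.card ≤ K + m) : IsWeaklyDR γ (hiddenFun γ K m O) := by
  intro A B hAB x hxB
  have hxA : x ∉ A := fun h => hxB (hAB h)
  have h1 : (A ∩ O).card ≤ (B ∩ O).card :=
    Finset.card_le_card (Finset.inter_subset_inter_right hAB)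
  have h2 : (A \ O).card ≤ (B \ O).card := Finset.card_le_card (Finset.sdiff_subset_sdiff hAB le_rfl)
  have h3 := Finset.card_sdiff_add_card_inter A O
  have anti := profile_antitone hγ0 hγ hK
  by_cases hx : x ∈ O
  · rcases lt_or_ge (B ∩ O).card m with hB | hB
    · rw [marginal_hiddenFun_of_mem_of_lt hx hxB hB,
        marginal_hiddenFun_of_mem_of_lt hx hxA (h1.trans_lt hB)]
      exact profile_step_le hγ0 hγ hK (Finset.card_le_card hAB)
    rw [marginal_hiddenFun_of_mem_of_ge hx hxB hB]
    rcases lt_or_ge (A ∩ O).card m with hA | hA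
    · rw [marginal_hiddenFun_of_mem_of_lt hx hxA hA]
      refine le_trans ?_ (profile_decay hγ hK A.card)
      have := anti (by omega : A.card ≤ (B \ O).card + m)
      gcongr
    · rw [marginal_hiddenFun_of_mem_of_ge hx hxA hA]
      have := anti (by omega : (A \ O).card + m ≤ (B \ O).card + m)
      have hB0 : 0 ≤ profile γ K ((B \ O).card + m) / K :=
        div_nonneg (profile_nonneg hγ hK _) (Nat.cast_nonneg K)
      refine (mul_le_of_le_one_left hB0 hγ).trans ?_
      gcongr
  · rw [marginal_hiddenFun_of_notMem hx hxB, marginal_hiddenFun_of_notMem hx hxA, mul_left_comm]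
    refine mul_le_mul ?_ (profile_step_le hγ0 hγ hK (by omega))
      (mul_nonneg hγ0 (sub_nonneg.2 (anti (Nat.le_succ _)))) (hidden_factor_nonneg hO A)
    gcongr

theorem hiddenFun_mem (hγ0 : 0 ≤ γ) (hγ : γ ≤ 1) (hK : 0 < K) {O : Finset N}
    (hO : O.card ≤ K + m) : hiddenFun γ K m O ∈ monotoneWeaklyDR γ N :=
  ⟨hiddenFun_nonneg hγ0 hγ hK O, hiddenFun_mono hγ0 hγ hK hO, hiddenFun_isWeaklyDR hγ0 hγ hK hO⟩

end HiddenSet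

/-! ### Random hidden sets -/

section Counting

open Finset

variable {N : Type*} [Fintype N] [DecidableEq N]

theorem card_powersetCard_filter_superset_le (J : Finset N) (k : ℕ) :
    #{O ∈ powersetCard k (univ : Finset N) | J ⊆ O} ≤
      (Fintype.card N - #J).choose (k - #J) := by
  have hc : #(powersetCard (k - #J) Jᶜ) = (Fintype.card N - #J).choose (k - #J) := by
    rw [card_powersetCard, card_compl]
  rw [← hc]
  refine card_le_card_of_injOn (fun O => O \ J) ?_ ?_
  · intro O hO
    have hO := mem_filter.1 (mem_coe.1 hO)
    refine mem_coe.2 (mem_powersetCard.2 ⟨fun x hx => ?_, ?_⟩)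
    · exact mem_compl.2 (mem_sdiff.1 hx).2
    · rw [card_sdiff_of_subset hO.2, (mem_powersetCard.1 hO.1).2]
  · intro O hO O' hO' h
    have hO := (mem_filter.1 (mem_coe.1 hO)).2
    have hO' := (mem_filter.1 (mem_coe.1 hO')).2
    rw [← sdiff_union_of_subset hO, ← sdiff_union_of_subset hO']
    exact congrArg (· ∪ J) h

theorem choose_sub_mul_pow_le {n k j : ℕ} (hjk : j ≤ k) (hkn : k ≤ n) :
    (n - j).choose (k - j) * n ^ j ≤ n.choose k * k ^ j := by
  induction j with
  | zero => simp
  | succ j ih =>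
    have ih := ih (by omega)
    have hn : n - j = n - (j + 1) + 1 := by omega
    have hk : k - j = k - (j + 1) + 1 := by omega
    have hpos : 0 < n - j := by omega
    have h1 : (n - j) * (n - (j + 1)).choose (k - (j + 1)) = (n - j).choose (k - j) * (k - j) := by
      rw [hn, hk]
      exact Nat.add_one_mul_choose_eq _ _
    have h2 : (k - j) * n ≤ k * (n - j) := by
      rw [Nat.sub_mul, Nat.mul_sub]
      have : j * k ≤ j * n := Nat.mul_le_mul_left j hkn
      rw [mul_comm k j]
      omega
    refine Nat.le_of_mul_le_mul_left ?_ hpos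
    calc (n - j) * ((n - (j + 1)).choose (k - (j + 1)) * n ^ (j + 1))
        = ((n - j) * (n - (j + 1)).choose (k - (j + 1))) * n ^ (j + 1) := by ring
      _ = ((n - j).choose (k - j) * n ^ j) * ((k - j) * n) := by rw [h1]; ring
      _ ≤ (n.choose k * k ^ j) * (k * (n - j)) := Nat.mul_le_mul ih h2
      _ = (n - j) * (n.choose k * k ^ (j + 1)) := by ring

/-- A uniformly random `k`-set contains a given set `J` with probability at most
`(k / n) ^ #J`. -/
theorem card_superset_le {J : Finset N} {k : ℕ} (hJ : #J ≤ k) (hk : k ≤ Fintype.card N)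
    (hk0 : 0 < k) :
    (#{O ∈ powersetCard k (univ : Finset N) | J ⊆ O} : ℝ) ≤
      (Fintype.card N).choose k * ((k : ℝ) / Fintype.card N) ^ #J := by
  have hn : (0 : ℝ) < Fintype.card N := by exact_mod_cast hk0.trans_le hk
  rw [div_pow, ← mul_div_assoc, le_div_iff₀ (by positivity)]
  exact_mod_cast (Nat.mul_le_mul_right _ (card_powersetCard_filter_superset_le J k)).trans
    (choose_sub_mul_pow_le hJ hk)

theorem sum_card_inter_hidden_le {k : ℕ} (hk : k ≤ Fintype.card N) (hk0 : 0 < k) (P : Finset N) :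
    ∑ O ∈ powersetCard k (univ : Finset N), (#(P ∩ O) : ℝ) ≤
      (Fintype.card N).choose k * (#P * ((k : ℝ) / Fintype.card N)) := by
  have h1 : ∀ O : Finset N, (#(P ∩ O) : ℝ) = ∑ x ∈ P, if x ∈ O then (1 : ℝ) else 0 := by
    intro O
    rw [Finset.sum_boole, Finset.filter_mem_eq_inter]
  simp only [h1]
  rw [sum_comm]
  have h2 : ∀ x ∈ P, (∑ O ∈ powersetCard k (univ : Finset N), if x ∈ O then (1 : ℝ) else 0) ≤
      (Fintype.card N).choose k * ((k : ℝ) / Fintype.card N) := by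
    intro x _
    rw [Finset.sum_boole]
    simpa using card_superset_le (J := {x}) (by rw [card_singleton]; exact hk0) hk hk0
  refine (sum_le_card_nsmul _ _ _ h2).trans_eq ?_
  rw [nsmul_eq_mul]
  ring

theorem choose_le_exp_mul_div_pow (s : ℕ) {j : ℕ} (hj : 0 < j) :
    (s.choose j : ℝ) ≤ (Real.exp 1 * s / j) ^ j := by
  have hj' : (0 : ℝ) < j := by exact_mod_cast hj
  have h1 : (s.choose j : ℝ) ≤ (s : ℝ) ^ j / j.factorial := Nat.choose_le_pow_div j s
  have h2 : (j : ℝ) ^ j / j.factorial ≤ Real.exp j := Real.pow_div_factorial_le_exp _ hj'.le j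
  have h3 : Real.exp (j : ℝ) = Real.exp 1 ^ j := by rw [← Real.exp_nat_mul, mul_one]
  have hf : (0 : ℝ) < j.factorial := by exact_mod_cast j.factorial_pos
  refine h1.trans ?_
  rw [div_pow, mul_pow, ← h3, le_div_iff₀ (by positivity)]
  calc (s : ℝ) ^ j / j.factorial * j ^ j = (j : ℝ) ^ j / j.factorial * s ^ j := by ring
    _ ≤ Real.exp j * s ^ j := by gcongr

/-- Union bound over the `j`-subsets of `S`: a uniformly random `k`-set meets `S` in at least `j`
elements with probability at most `(e * #S * k / (j * n)) ^ j`. -/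
theorem card_large_inter_le {k j : ℕ} (hk : k ≤ Fintype.card N) (hj : 0 < j) (hjk : j ≤ k)
    (S : Finset N) :
    (#{O ∈ powersetCard k (univ : Finset N) | j ≤ #(S ∩ O)} : ℝ) ≤
      (Fintype.card N).choose k *
        (Real.exp 1 * #S / j * ((k : ℝ) / Fintype.card N)) ^ j := by
  have hsub : {O ∈ powersetCard k (univ : Finset N) | j ≤ #(S ∩ O)} ⊆
      (powersetCard j S).biUnion fun J => {O ∈ powersetCard k (univ : Finset N) | J ⊆ O} := by
    intro O hO
    obtain ⟨hO, hjO⟩ := mem_filter.1 hO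
    obtain ⟨J, hJ, hJc⟩ := exists_subset_card_eq hjO
    exact mem_biUnion.2 ⟨J, mem_powersetCard.2 ⟨hJ.trans inter_subset_left, hJc⟩,
      mem_filter.2 ⟨hO, hJ.trans inter_subset_right⟩⟩
  have h1 : (#{O ∈ powersetCard k (univ : Finset N) | j ≤ #(S ∩ O)} : ℝ) ≤
      ∑ J ∈ powersetCard j S, (#{O ∈ powersetCard k (univ : Finset N) | J ⊆ O} : ℝ) := by
    exact_mod_cast (card_le_card hsub).trans card_biUnion_le
  have h2 : ∀ J ∈ powersetCard j S, (#{O ∈ powersetCard k (univ : Finset N) | J ⊆ O} : ℝ) ≤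
      (Fintype.card N).choose k * ((k : ℝ) / Fintype.card N) ^ j := by
    intro J hJ
    obtain ⟨-, hJc⟩ := mem_powersetCard.1 hJ
    have := card_superset_le (J := J) (by omega) hk (hj.trans_le hjk)
    rwa [hJc] at this
  refine (h1.trans (sum_le_card_nsmul _ _ _ h2)).trans ?_
  rw [nsmul_eq_mul, card_powersetCard, mul_pow]
  calc ((#S).choose j : ℝ) * ((Fintype.card N).choose k * ((k : ℝ) / Fintype.card N) ^ j)
      ≤ (Real.exp 1 * #S / j) ^ j *
        ((Fintype.card N).choose k * ((k : ℝ) / Fintype.card N) ^ j) := by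
        gcongr
        exact choose_le_exp_mul_div_pow _ hj
    _ = _ := by ring

end Counting

/-! ### Indistinguishability -/

/-- If every single query separates few of the functions `F i` from `g`, then few of the `F i` make
the algorithm output something else than it does on `g`: until its first separating query the
algorithm runs as on `g`. -/
theorem card_result_ne_le {N ι : Type*} [DecidableEq N] (I : Finset ι) (F : ι → Finset N → ℝ)
    (g : Finset N → ℝ) {b : ℝ} (hb : ∀ S, ((I.filter fun i => F i S ≠ g S).card : ℝ) ≤ b)
    (T : QueryAlg N) :
    ((I.filter fun i => T.result (F i) ≠ T.result g).card : ℝ) ≤ T.numQueries g * b := by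
  classical
  induction T with
  | output P => simp [QueryAlg.result, QueryAlg.numQueries]
  | query S next ih =>
    have hsub : (I.filter fun i => (QueryAlg.query S next).result (F i) ≠
          (QueryAlg.query S next).result g) ⊆
        (I.filter fun i => F i S ≠ g S) ∪
          I.filter fun i => (next (g S)).result (F i) ≠ (next (g S)).result g := by
      intro i hi
      obtain ⟨hI, hi⟩ := Finset.mem_filter.1 hi
      by_cases h : F i S = g S
      · refine Finset.mem_union_right _ (Finset.mem_filter.2 ⟨hI, ?_⟩)
        rwa [QueryAlg.result, QueryAlg.result, h] at hi
      · exact Finset.mem_union_left _ (Finset.mem_filter.2 ⟨hI, h⟩)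
    have h1 := (Finset.card_le_card hsub).trans (Finset.card_union_le _ _)
    have h2 : ((I.filter fun i => (QueryAlg.query S next).result (F i) ≠
          (QueryAlg.query S next).result g).card : ℝ) ≤
        (I.filter fun i => F i S ≠ g S).card +
          (I.filter fun i => (next (g S)).result (F i) ≠ (next (g S)).result g).card := by
      exact_mod_cast h1
    have h3 := ih (g S)
    have h4 := hb S
    rw [QueryAlg.numQueries]
    push_cast
    linarith

/-! ### Asymptotics -/

theorem Polynomial.exists_eval_natCast_le (C : Polynomial ℝ) :
    ∃ M : ℝ, 0 ≤ M ∧ ∀ n : ℕ, 1 ≤ n → C.eval (n : ℝ) ≤ M * (n : ℝ) ^ C.natDegree := by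
  refine ⟨∑ i ∈ Finset.range (C.natDegree + 1), |C.coeff i|,
    Finset.sum_nonneg fun _ _ => abs_nonneg _, fun n hn => ?_⟩
  rw [Polynomial.eval_eq_sum_range, Finset.sum_mul]
  have hn' : (1 : ℝ) ≤ n := by exact_mod_cast hn
  refine Finset.sum_le_sum fun i hi => ?_
  have hi : i ≤ C.natDegree := by
    have := Finset.mem_range.1 hi
    omega
  exact mul_le_mul (le_abs_self _) (pow_le_pow_right₀ hn' hi) (by positivity) (abs_nonneg _)

/-- Polynomially many queries do not find a separating set, uniformly in `n ≥ 60 * k / ε`. With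
`r = 9 * e * k / (ε * n) ≤ 1 / 2` one has `n ^ d * r ^ j = (9 * e * k / ε) ^ d * r ^ (j - d)`, which
is a polynomial in `k` times an exponentially small factor. -/
theorem exists_forall_eval_mul_pow_le {ε η : ℝ} (hε : 0 < ε) (hη : 0 < η) (C : Polynomial ℝ) :
    ∃ k₀ : ℕ, ∀ k : ℕ, k₀ ≤ k → 1 ≤ k → ∀ n : ℕ, 60 * (k : ℝ) / ε ≤ n → ∀ j : ℕ, ε * k / 3 ≤ j →
      C.eval (n : ℝ) * (9 * Real.exp 1 * k / (ε * n)) ^ j ≤ η := by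
  obtain ⟨M, hM, hC⟩ := C.exists_eval_natCast_le
  set d := C.natDegree
  set B := 9 * Real.exp 1 / ε with hB
  have hB0 : 0 < B := by positivity
  set θ : ℝ := (1 / 2 : ℝ) ^ (ε / 3) with hθ
  have hθ0 : 0 ≤ θ := by positivity
  have hθ1 : θ < 1 := Real.rpow_lt_one (by norm_num) (by norm_num) (by positivity)
  have hlim := (tendsto_pow_const_mul_const_pow_of_lt_one d hθ0 hθ1).const_mul (M * (2 * B) ^ d)
  rw [mul_zero] at hlim
  obtain ⟨k₁, hk₁⟩ := Filter.eventually_atTop.1 (hlim.eventually_le_const hη)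
  refine ⟨max k₁ ⌈3 * d / ε⌉₊, fun k hk hk1 n hn j hj => ?_⟩
  have hk0 : (1 : ℝ) ≤ k := by exact_mod_cast hk1
  have hn0 : (0 : ℝ) < n := lt_of_lt_of_le (by positivity) hn
  have hn1 : 1 ≤ n := by exact_mod_cast hn0
  have hdk : 3 * d / ε ≤ (k : ℝ) :=
    (Nat.le_ceil _).trans (by exact_mod_cast (le_max_right _ _).trans hk)
  have hdj : d ≤ j := by
    have : (d : ℝ) ≤ ε * k / 3 := by
      rw [div_le_iff₀ hε] at hdk
      linarith
    exact_mod_cast this.trans hj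
  set r := 9 * Real.exp 1 * k / (ε * n) with hr
  have hr0 : 0 ≤ r := by positivity
  have hr2 : r ≤ 1 / 2 := by
    rw [hr, div_le_iff₀ (by positivity)]
    rw [div_le_iff₀ hε] at hn
    have := Real.exp_one_lt_three
    nlinarith
  have hnr : n * r = B * k := by
    rw [hr, hB]
    field_simp
  have hpow : (1 / 2 : ℝ) ^ j ≤ θ ^ k := by
    rw [hθ, ← Real.rpow_natCast, ← Real.rpow_mul_natCast (by norm_num)]
    exact Real.rpow_le_rpow_of_exponent_ge (by norm_num) (by norm_num) (by linarith)
  calc C.eval (n : ℝ) * r ^ j ≤ M * (n : ℝ) ^ d * r ^ j := by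
        gcongr
        exact hC n hn1
    _ = M * (n * r) ^ d * r ^ (j - d) := by
        rw [← Nat.sub_add_cancel hdj, pow_add, mul_pow, Nat.add_sub_cancel]
        ring
    _ ≤ M * (B * k) ^ d * (1 / 2) ^ (j - d) := by
        rw [hnr]
        gcongr
    _ = M * (2 * B) ^ d * (k : ℝ) ^ d * (1 / 2) ^ j := by
        conv_rhs => rw [← Nat.sub_add_cancel hdj, pow_add]
        simp only [mul_pow, div_pow, one_pow]
        field_simp
    _ ≤ M * (2 * B) ^ d * (k : ℝ) ^ d * θ ^ k := by gcongr
    _ = M * (2 * B) ^ d * ((k : ℝ) ^ d * θ ^ k) := by ring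
    _ ≤ η := hk₁ k ((le_max_left _ _).trans hk)

/-! ### From average to worst case -/

theorem bestValue_le {N : Type*} {f : Finset N → ℝ} {P : Finset N} {k : ℕ} {c : ℝ}
    (h : ∀ S ⊆ P, S.card ≤ k → f S ≤ c) : bestValue f P k ≤ c :=
  Finset.sup'_le _ _ fun S hS =>
    h S (Finset.mem_powerset.1 (Finset.mem_filter.1 hS).1) (Finset.mem_filter.1 hS).2

theorem le_optValue {N : Type*} [Fintype N] (f : Finset N → ℝ) {S : Finset N} {k : ℕ}
    (hS : S.card ≤ k) : f S ≤ optValue f k :=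
  Finset.le_sup' f (Finset.mem_filter.2 ⟨Finset.mem_powerset.2 (Finset.subset_univ S), hS⟩)

theorem integrable_bestValue_result {Ω N : Type*} [Fintype N] [MeasurableSpace Ω]
    {μ : Measure Ω} [IsFiniteMeasure μ] {A : Ω → QueryAlg N} {f : Finset N → ℝ}
    (hA : ∀ P : Finset N, MeasurableSet {ω | (A ω).result f = P}) (k : ℕ) :
    Integrable (fun ω => bestValue f ((A ω).result f) k) μ := by
  classical
  let _ : MeasurableSpace (Finset N) := ⊤
  have h1 : Measurable fun ω => (A ω).result f := measurable_to_countable' hA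
  have h2 : Measurable fun P : Finset N => bestValue f P k := measurable_from_top
  refine Integrable.of_bound (h2.comp h1).aestronglyMeasurable
    (∑ P : Finset N, |bestValue f P k|) (Filter.Eventually.of_forall fun ω => ?_)
  exact Finset.single_le_sum (f := fun P : Finset N => |bestValue f P k|)
    (fun P _ => abs_nonneg _) (Finset.mem_univ _)

/-- Yao's principle: a family of functions on which the average value of the output is at most `β`
for almost every deterministic realisation contains one with expected value at most `β`, hence below `α` times the optimum. -/
theorem exists_integral_lt_of_sum_le {Ω N ι : Type*} [Fintype N] [MeasurableSpace Ω]
    {μ : Measure Ω} [IsProbabilityMeasure μ] {A : Ω → QueryAlg N} {I : Finset ι}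
    {F : ι → Finset N → ℝ} {k : ℕ} {α β : ℝ}
    (hA : ∀ i ∈ I, ∀ P : Finset N, MeasurableSet {ω | (A ω).result (F i) = P})
    (hI : 0 < I.card) (hα : 0 ≤ α) (hβ : β < α)
    (hopt : ∀ i ∈ I, 1 ≤ optValue (F i) k)
    (hsum : ∀ᵐ ω ∂μ, ∑ i ∈ I, bestValue (F i) ((A ω).result (F i)) k ≤ I.card * β) :
    ∃ i ∈ I, ∫ ω, bestValue (F i) ((A ω).result (F i)) k ∂μ < α * optValue (F i) k := by
  have hint := fun i hi => integrable_bestValue_result (μ := μ) (hA i hi) k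
  have h1 : ∑ i ∈ I, ∫ ω, bestValue (F i) ((A ω).result (F i)) k ∂μ ≤ I.card * β := by
    rw [← integral_finsetSum I hint]
    refine (integral_mono_ae (integrable_finsetSum I hint) (integrable_const _) hsum).trans_eq ?_
    simp
  have h2 : ∑ i ∈ I, ∫ ω, bestValue (F i) ((A ω).result (F i)) k ∂μ < ∑ _i ∈ I, α := by
    rw [Finset.sum_const, nsmul_eq_mul]
    have : (0 : ℝ) < I.card := by exact_mod_cast hI
    exact h1.trans_lt (mul_lt_mul_of_pos_left hβ this)
  obtain ⟨i, hi, h⟩ := Finset.exists_lt_of_sum_lt h2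
  exact ⟨i, hi, h.trans_le (le_mul_of_one_le_right hα (hopt i hi))⟩

/-- A factor above `1` is refuted by a constant function. -/
theorem noPrunerGuarantees_of_one_lt {N : Type v} [Fintype N] [DecidableEq N] {γ α : ℝ}
    (hα : 1 < α) (q : ℝ) (p k : ℕ) :
    NoPrunerGuarantees.{u, v} (monotoneWeaklyDR γ N) q p k α := by
  intro Ω _ μ _ A _
  refine ⟨fun _ => 1, ⟨fun _ => zero_le_one, monotone_const, fun _ _ _ _ _ => ?_⟩, ?_⟩
  · simp [marginal]
  · have h : ∀ P : Finset N, bestValue (fun _ => (1 : ℝ)) P k = 1 := fun P => Finset.sup'_const _ 1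
    simpa [optValue, h] using hα

/-! ### The hidden-set distribution defeats every algorithm -/

section Average

open Finset

variable {N : Type*} [Fintype N] [DecidableEq N] {γ : ℝ} {K m : ℕ}

/-- A query `S` separates `hiddenFun γ K m O` from the symmetric function only if
`#S < 3 * K` and `#(S ∩ O) > m`, which is rare. -/
theorem card_hiddenFun_ne_le {k : ℕ} (hkm : k = K + m) (hmk : m + 1 ≤ k)
    (hk : k ≤ Fintype.card N) (S : Finset N) :
    (#{O ∈ powersetCard k (univ : Finset N) | hiddenFun γ K m O S ≠ hiddenFun γ K m ∅ S} : ℝ) ≤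
      (Fintype.card N).choose k *
        (3 * Real.exp 1 * k / (m + 1) * ((k : ℝ) / Fintype.card N)) ^ (m + 1) := by
  rcases lt_or_ge #S (3 * K) with hS | hS
  · have hsub : {O ∈ powersetCard k (univ : Finset N) |
        hiddenFun γ K m O S ≠ hiddenFun γ K m ∅ S} ⊆
        {O ∈ powersetCard k (univ : Finset N) | m + 1 ≤ #(S ∩ O)} := by
      refine monotone_filter_right _ fun O _ hO => ?_
      by_contra h
      exact hO (hiddenFun_eq_of_card_inter_le (by omega))
    have h1 : (#{O ∈ powersetCard k (univ : Finset N) |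
        hiddenFun γ K m O S ≠ hiddenFun γ K m ∅ S} : ℝ) ≤
        #{O ∈ powersetCard k (univ : Finset N) | m + 1 ≤ #(S ∩ O)} := by
      exact_mod_cast card_le_card hsub
    refine (h1.trans (card_large_inter_le hk m.succ_pos hmk S)).trans ?_
    have hS' : (#S : ℝ) ≤ 3 * k := by exact_mod_cast (by omega : #S ≤ 3 * k)
    push_cast
    gcongr _ * (?_ * _) ^ _
    rw [mul_comm (3 : ℝ), mul_assoc]
    gcongr
  · rw [filter_eq_empty_iff.2]
    · rw [card_empty, Nat.cast_zero]
      positivity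
    · intro O hO
      rw [not_not]
      exact hiddenFun_eq_of_card_ge (by rw [(mem_powersetCard.1 hO).2, hkm]) hS

/-- Average value of the output of a deterministic algorithm over all hidden sets: the symmetric
value, plus the gain from the hidden elements that the output on the symmetric function happens to
contain, plus the probability `q * δ` that some query separates. -/
theorem sum_bestValue_hiddenFun_le (hγ0 : 0 ≤ γ) (hγ : γ ≤ 1) (hK : 0 < K) {k p : ℕ}
    (hkm : k = K + m) (hk : k ≤ Fintype.card N) {δ q : ℝ} (hδ : 0 ≤ δ)
    (hsep : ∀ S : Finset N, (#{O ∈ powersetCard k (univ : Finset N) |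
      hiddenFun γ K m O S ≠ hiddenFun γ K m ∅ S} : ℝ) ≤ (Fintype.card N).choose k * δ)
    (T : QueryAlg N) (hq : (T.numQueries (hiddenFun γ K m ∅) : ℝ) ≤ q)
    (hp : #(T.result (hiddenFun γ K m ∅)) ≤ p) :
    ∑ O ∈ powersetCard k (univ : Finset N),
        bestValue (hiddenFun γ K m O) (T.result (hiddenFun γ K m O)) k ≤
      #(powersetCard k (univ : Finset N)) *
        (1 - profile γ K k + p * ((k : ℝ) / Fintype.card N) / K + q * δ) := by
  set P := T.result (hiddenFun γ K m ∅) with hP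
  have hprof : 0 ≤ 1 - profile γ K k := sub_nonneg.2 (profile_le_one hγ0 hγ hK k)
  have hterm : ∀ O ∈ powersetCard k (univ : Finset N),
      bestValue (hiddenFun γ K m O) (T.result (hiddenFun γ K m O)) k ≤
        1 - profile γ K k + #(P ∩ O) / K +
          if T.result (hiddenFun γ K m O) ≠ P then (1 : ℝ) else 0 := by
    intro O hO
    have hOc : #O ≤ K + m := by rw [(mem_powersetCard.1 hO).2, hkm]
    by_cases h : T.result (hiddenFun γ K m O) = P
    · rw [h, if_neg (not_not.2 rfl), add_zero]
      refine bestValue_le fun S hSP hS => ?_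
      rw [hkm] at hS ⊢
      refine (hiddenFun_le hγ0 hγ hK hS).trans ?_
      have := card_le_card (inter_subset_inter_right (u := O) hSP)
      gcongr
    · rw [if_pos h]
      have : (0 : ℝ) ≤ #(P ∩ O) / K := by positivity
      exact (bestValue_le fun S _ _ => hiddenFun_le_one hγ hK hOc S).trans (by linarith)
  refine (sum_le_sum hterm).trans ?_
  rw [sum_add_distrib, sum_add_distrib, sum_const, nsmul_eq_mul, ← sum_div, sum_boole,
    card_powersetCard, card_univ]
  have h1 := sum_card_inter_hidden_le hk (by omega) P
  have h2 := card_result_ne_le (powersetCard k (univ : Finset N)) (hiddenFun γ K m)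
    (hiddenFun γ K m ∅) hsep T
  have h3 : (#P : ℝ) ≤ p := by exact_mod_cast hp
  have hc : (0 : ℝ) ≤ (Fintype.card N).choose k := Nat.cast_nonneg _
  calc ((Fintype.card N).choose k : ℝ) * (1 - profile γ K k) +
        (∑ O ∈ powersetCard k (univ : Finset N), (#(P ∩ O) : ℝ)) / K +
        #{O ∈ powersetCard k (univ : Finset N) | T.result (hiddenFun γ K m O) ≠ P}
      ≤ (Fintype.card N).choose k * (1 - profile γ K k) +
        (Fintype.card N).choose k * (p * ((k : ℝ) / Fintype.card N)) / K +
        q * ((Fintype.card N).choose k * δ) := by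
        gcongr
        · refine h1.trans ?_
          gcongr
        · refine h2.trans ?_
          gcongr
    _ = _ := by ring

end Average

theorem exists_noPrunerGuarantees {γ ε : ℝ} (hγ0 : 0 < γ) (hγ : γ ≤ 1) (hε : 0 < ε)
    (C : Polynomial ℝ) :
    ∃ k₀ : ℕ, ∀ k : ℕ, k₀ ≤ k → ∀ p : ℕ, k ≤ p →
      ∀ (N : Type v) [Fintype N] [DecidableEq N],
        Fintype.card N = ⌈60 * (p : ℝ) / ε⌉₊ →
        NoPrunerGuarantees.{u, v} (monotoneWeaklyDR γ N)
          (C.eval (Fintype.card N : ℝ)) p k (1 - Real.exp (-γ) + ε) := by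
  have hexp : Real.exp (-γ) ≤ 1 := Real.exp_le_one_iff.2 (by linarith)
  rcases lt_or_ge 1 ε with hε1 | hε1
  · refine ⟨0, fun k _ p _ N _ _ _ => noPrunerGuarantees_of_one_lt ?_ _ _ _⟩
    linarith
  obtain ⟨k₁, hk₁⟩ := exists_forall_eval_mul_pow_le hε (by positivity : 0 < ε / 8) C
  have hlim := Real.tendsto_one_add_div_pow_exp (-γ)
  obtain ⟨K₀, hK₀⟩ := Filter.eventually_atTop.1
    (hlim.eventually_const_le (show Real.exp (-γ) - ε / 8 < Real.exp (-γ) by linarith))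
  refine ⟨k₁ + 2 * K₀ + 1, fun k hk p hp N _ _ hN Ω _ μ _ A hA => ?_⟩
  -- Up to `m` hidden elements stay invisible; both `m / K ≤ ε / 2` and the separation
  -- probability depend on this choice.
  set m := ⌊ε * k / 3⌋₊ with hm
  have hk0 : (1 : ℝ) ≤ k := by exact_mod_cast (by omega : 1 ≤ k)
  have hmε : (m : ℝ) ≤ ε * k / 3 := Nat.floor_le (by positivity)
  have hm3 : (3 : ℝ) * m ≤ k := by nlinarith
  have hm3' : 3 * m ≤ k := by exact_mod_cast hm3
  obtain ⟨K, hkm⟩ : ∃ K, k = K + m := ⟨k - m, by omega⟩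
  have hK : 0 < K := by omega
  have hkmR : (k : ℝ) = K + m := by exact_mod_cast hkm
  have hKR : (0 : ℝ) < K := by exact_mod_cast hK
  have hK23 : 2 * (k : ℝ) ≤ 3 * K := by linarith
  have hpR : (k : ℝ) ≤ p := by exact_mod_cast hp
  have hn : 60 * (p : ℝ) / ε ≤ Fintype.card N := by
    rw [hN]
    exact Nat.le_ceil _
  have hn' : 60 * (p : ℝ) ≤ ε * Fintype.card N := by
    rw [div_le_iff₀ hε] at hn
    linarith
  have hn0 : (0 : ℝ) < Fintype.card N := by nlinarith
  have hkn : k ≤ Fintype.card N := by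
    have : (k : ℝ) ≤ Fintype.card N := by nlinarith
    exact_mod_cast this
  set δ : ℝ := (3 * Real.exp 1 * k / (m + 1) * ((k : ℝ) / Fintype.card N)) ^ (m + 1) with hδ
  have hδ0 : 0 ≤ δ := by positivity
  have hmj : ε * k / 3 ≤ ((m + 1 : ℕ) : ℝ) := by
    push_cast
    exact (Nat.lt_floor_add_one _).le
  set q : ℝ := max (C.eval (Fintype.card N : ℝ)) 0 with hq
  have hqδ : q * δ ≤ ε / 8 := by
    rw [hq, max_mul_of_nonneg _ _ hδ0, zero_mul]
    refine max_le ?_ (by positivity)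
    rcases le_or_gt (C.eval (Fintype.card N : ℝ)) 0 with h0 | h0
    · exact (mul_nonpos_of_nonpos_of_nonneg h0 hδ0).trans (by positivity)
    refine le_trans ?_ (hk₁ k (by omega) (by omega) _ (le_trans (by gcongr) hn) (m + 1) hmj)
    rw [hδ]
    gcongr _ * ?_ ^ _
    push_cast at hmj
    calc 3 * Real.exp 1 * k / (m + 1) * ((k : ℝ) / Fintype.card N)
        ≤ 3 * Real.exp 1 * k / (ε * k / 3) * ((k : ℝ) / Fintype.card N) := by gcongr
      _ = 9 * Real.exp 1 * k / (ε * Fintype.card N) := by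
        field_simp
        ring
  have hprof : Real.exp (-γ) - ε / 8 - ε / 2 ≤ profile γ K k := by
    have h1 := le_profile_add hγ0.le hγ hK m
    have h2 := hK₀ K (by omega)
    rw [neg_div, ← sub_eq_add_neg] at h2
    have h3 : (m : ℝ) / K ≤ ε / 2 := by
      rw [div_le_iff₀ hKR]
      nlinarith
    rw [hkm]
    linarith
  have hout : p * ((k : ℝ) / Fintype.card N) / K ≤ ε / 40 := by
    rw [div_le_iff₀ hKR, ← mul_div_assoc, div_le_iff₀ hn0]
    nlinarith
  have hcard : ∀ O ∈ Finset.powersetCard k (Finset.univ : Finset N), O.card = K + m :=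
    fun O hO => (Finset.mem_powersetCard.1 hO).2.trans hkm
  have hmem : ∀ O ∈ Finset.powersetCard k (Finset.univ : Finset N),
      hiddenFun γ K m O ∈ monotoneWeaklyDR γ N :=
    fun O hO => hiddenFun_mem hγ0.le hγ hK (hcard O hO).le
  have hI : 0 < (Finset.powersetCard k (Finset.univ : Finset N)).card := by
    rw [Finset.card_powersetCard, Finset.card_univ]
    exact Nat.choose_pos hkn
  obtain ⟨O, hO, h⟩ := exists_integral_lt_of_sum_le (μ := μ) (A := A) (F := hiddenFun γ K m)
    (k := k) (α := 1 - Real.exp (-γ) + ε)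
    (β := 1 - profile γ K k + p * ((k : ℝ) / Fintype.card N) / K + q * δ)
    (fun O hO => (hA _ (hmem O hO)).1) hI (by linarith) (by linarith)
    (fun O hO => (hiddenFun_self hK (hcard O hO)).ge.trans
      (le_optValue _ ((hcard O hO).trans hkm.symm).le)) (by
      filter_upwards [(hA _ (hiddenFun_mem hγ0.le hγ hK (O := ∅) (by simp))).2] with ω hω
      exact sum_bestValue_hiddenFun_le hγ0.le hγ hK hkm hkn hδ0
        (card_hiddenFun_ne_le hkm (by omega) hkn) (A ω) (hω.1.trans (le_max_left _ _)) hω.2)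
  exact ⟨_, hmem O hO, h⟩

theorem monotoneSubmodular_eq_monotoneWeaklyDR_one (N : Type*) [DecidableEq N] :
    monotoneSubmodular N = monotoneWeaklyDR 1 N := by
  simp [monotoneSubmodular, monotoneWeaklyDR, IsSubmodular, IsWeaklyDR]

theorem theorem1 :
    (∀ γ : ℝ, 0 < γ → γ ≤ 1 → ∀ ε : ℝ, 0 < ε → ∀ C : Polynomial ℝ,
      ∃ k₀ : ℕ, ∀ k : ℕ, k₀ ≤ k → ∀ p : ℕ, k ≤ p →
        ∀ (N : Type v) [Fintype N] [DecidableEq N],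
          Fintype.card N = ⌈60 * (p : ℝ) / ε⌉₊ →
          NoPrunerGuarantees.{u, v} (monotoneWeaklyDR γ N)
            (C.eval (Fintype.card N : ℝ)) p k (1 - Real.exp (-γ) + ε)) ∧
    (∀ α : ℝ, 1 - 1 / Real.exp 1 < α → ∀ C : Polynomial ℝ,
      ∃ k₀ : ℕ, ∀ k : ℕ, k₀ ≤ k → ∀ p : ℕ, k ≤ p →
        ∀ (N : Type v) [Fintype N] [DecidableEq N],
          Fintype.card N = ⌈60 * (p : ℝ) / (α - (1 - 1 / Real.exp 1))⌉₊ →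
          NoPrunerGuarantees.{u, v} (monotoneSubmodular N)
            (C.eval (Fintype.card N : ℝ)) p k α) := by
  refine ⟨fun γ hγ0 hγ ε hε C => exists_noPrunerGuarantees hγ0 hγ hε C, fun α hα C => ?_⟩
  obtain ⟨k₀, h⟩ := exists_noPrunerGuarantees.{u, v} one_pos le_rfl (sub_pos.2 hα) C
  refine ⟨k₀, fun k hk p hp N _ _ hN => ?_⟩
  have hα' : 1 - Real.exp (-1) + (α - (1 - 1 / Real.exp 1)) = α := by
    rw [Real.exp_neg, one_div]
    ring
  rw [monotoneSubmodular_eq_monotoneWeaklyDR_one, ← hα']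
  exact h k hk p hp N hN
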